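/- Let $n \ge 3$. Let $\mathbb{S}^{n-1}$ be the unit sphere of $\mathbb{R}^n$ with its round metric $d\sigma^2$, and let $d(x,y)=\arccos\langle x,y\rangle$ be the associated distance. Identify the universal cover $\widetilde{Ein}_{1,n-1}$ of the Einstein universe with $\mathbb{S}^{n-1}\times\mathbb{R}$, equipped with the conformal class of the Lorentzian metric $d\sigma^2-dt^2$ and the time orientation for which $\partial_t$ is future-directed. A future-directed causal curve is a piecewise $C^1$ curve whose tangent vectors are all timelike or lightlike and future-directed; a causal curve is a future-directed causal curve or one run backwards. A subset $\Omega$ is causally convex if, for all $p,q\in\Omega$, every causal curve of $\mathbb{S}^{n-1}\times\mathbb{R}$ joining $p$ to $q$ is contained in $\Omega$. A function $f:U\to\overline{\mathbb{R}}=[-\infty,+\infty]$ on a subset $U\subset\mathbb{S}^{n-1}$ is called $1$-Lipschitz if $f(x)\le f(y)+d(x,y)$ for all $x,y\in U$ (so, if $U\neq\emptyset$, $f$ is either real-valued and $1$-Lipschitz in the usual sense, or constant equal to $+\infty$, or constant equal to $-\infty$). Then a subset $\Omega\subset\mathbb{S}^{n-1}\times\mathbb{R}$ is open and causally convex if and only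 if there exist an open subset $U$ of $\mathbb{S}^{n-1}$ and two $1$-Lipschitz functions $f^-,f^+:U\to\overline{\mathbb{R}}$ such that 1. $f^-<f^+$ on $U$; 2. the continuous extensions of $f^-$ and $f^+$ to $\partial U$ coincide, i.e. for every $x\in\partial U$ the limits of $f^-(y)$ and of $f^+(y)$ as $y\to x$, $y\in U$, exist in $\overline{\mathbb{R}}$ and are equal; 3. $\Omega=\{(x,t): x\in U,\ f^-(x)<t<f^+(x)\}$. -/

import Mathlib

open Set Filter Topology

/-- The unit sphere `S^{n-1}` of the Euclidean space `ℝ^n`. -/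
abbrev UnitSph (n : ℕ) : Type := Metric.sphere (0 : EuclideanSpace ℝ (Fin n)) 1

/-- The universal Einstein universe of dimension `n` in a spatio-temporal decomposition, as the
manifold `S^{n-1} × ℝ`.  Its conformal class is that of the Lorentzian metric `dσ² - dt²`, which
enters through `lorentzForm` below. -/
abbrev EinUniv (n : ℕ) : Type := UnitSph n × ℝ

/-- The embedding of `S^{n-1} × ℝ` in `ℝ^n × ℝ`.  Tangent vectors of `S^{n-1} × ℝ` are regarded
as vectors of `ℝ^n × ℝ` through it. -/
def einEmb (n : ℕ) (p : EinUniv n) : EuclideanSpace ℝ (Fin n) × ℝ :=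
  ((p.1 : EuclideanSpace ℝ (Fin n)), p.2)

/-- The quadratic form of the metric `dσ² - dt²`: the round metric `dσ²` is the one induced on the
sphere by the Euclidean metric of `ℝ^n`. -/
noncomputable def lorentzForm {n : ℕ} (v : EuclideanSpace ℝ (Fin n) × ℝ) : ℝ :=
  ‖v.1‖ ^ 2 - v.2 ^ 2

/-- Future-directed causal (timelike or lightlike) vectors; the time orientation is the one for
which `∂/∂t` is future-directed. -/
def IsFutureCausalVec {n : ℕ} (v : EuclideanSpace ℝ (Fin n) × ℝ) : Prop :=
  v ≠ 0 ∧ lorentzForm v ≤ 0 ∧ 0 < v.2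

/-- `γ`, restricted to `[a, b]` with `a < b`, is a `C¹` curve all of whose tangent vectors
(one-sided at the end points) are future-directed causal. -/
def IsFutureCausalArc {n : ℕ} (γ : ℝ → EinUniv n) (a b : ℝ) : Prop :=
  a < b ∧ ContDiffOn ℝ 1 (fun τ => einEmb n (γ τ)) (Icc a b) ∧
    ∀ τ ∈ Icc a b, IsFutureCausalVec (derivWithin (fun τ => einEmb n (γ τ)) (Icc a b) τ)

/-- `γ`, restricted to `[a, b]`, is a (piecewise `C¹`) future-directed causal curve: a finite
concatenation of future-directed causal `C¹` arcs. -/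
inductive IsFutureCausalCurve {n : ℕ} (γ : ℝ → EinUniv n) : ℝ → ℝ → Prop
  | arc {a b : ℝ} : IsFutureCausalArc γ a b → IsFutureCausalCurve γ a b
  | concat {a b c : ℝ} : IsFutureCausalCurve γ a b → IsFutureCausalCurve γ b c →
      IsFutureCausalCurve γ a c

/-- `Ω` is causally convex: for all `p, q ∈ Ω`, every causal curve joining `p` to `q` is contained
in `Ω`.  A past-directed causal curve from `p` to `q` is a future-directed one from `q` to `p` run
backwards, so future-directed curves are enough. -/
def CausallyConvex {n : ℕ} (Ω : Set (EinUniv n)) : Prop :=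
  ∀ p ∈ Ω, ∀ q ∈ Ω, ∀ (γ : ℝ → EinUniv n) (a b : ℝ),
    IsFutureCausalCurve γ a b → γ a = p → γ b = q → ∀ τ ∈ Icc a b, γ τ ∈ Ω

/-- The distance on the unit sphere induced by the round metric: the length
`arccos ⟪x, y⟫ ∈ [0, π]` of the shortest great-circle arc from `x` to `y`. -/
noncomputable def roundDist {n : ℕ} (x y : UnitSph n) : ℝ :=
  InnerProductGeometry.angle (x : EuclideanSpace ℝ (Fin n)) (y : EuclideanSpace ℝ (Fin n))

/-- `f : U → [-∞, +∞]` is `1`-Lipschitz for the round distance: `f x ≤ f y + d(x, y)` on `U`.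
If `U` is non-empty, then `f` is either real-valued and `1`-Lipschitz in the usual sense, or
constant equal to `+∞`, or constant equal to `-∞`.  Values of `f` outside `U` play no role. -/
def IsOneLipschitzOn {n : ℕ} (f : UnitSph n → EReal) (U : Set (UnitSph n)) : Prop :=
  ∀ x ∈ U, ∀ y ∈ U, f x ≤ f y + ((roundDist x y : ℝ) : EReal)

/-- The continuous extensions of `f|U` and `g|U` to `∂U` exist and coincide: at each point of the
boundary of `U`, both functions have the same limit in `[-∞, +∞]` along `U`. -/
def BoundaryExtensionsCoincide {n : ℕ} (f g : UnitSph n → EReal) (U : Set (UnitSph n)) : Prop :=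
  ∀ x ∈ frontier U, ∃ l : EReal, Tendsto f (𝓝[U] x) (𝓝 l) ∧ Tendsto g (𝓝[U] x) (𝓝 l)

/-! ### Metric and differential properties of the round distance. -/

section RoundDistance

variable {n : ℕ}

/-! For points `(x, s)`, `(y, t)` with `s < t`, a future causal curve from the first to the second
exists exactly when `d(x, y) ≤ t - s` (`IsFutureCausalCurve.roundDist_le`,
`exists_isFutureCausalArc`). Causal convexity thus becomes order convexity for these cones
(`CausallyConvex.mem_of_between`).

Given `Ω`, the fibres over its projection `U` are open intervals, and their endpoints define `f^±`.
A failure of the Lipschitz bound, or distinct limits at a point of `∂U`, would put between two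
points of `Ω` a point that cannot belong to it.

Conversely, extend `f^±` to the whole sphere (`IsOneLipschitzOn.exists_extension`). Along a causal
curve with endpoints in the region, the Lipschitz bounds preserve `f^- < t < f^+`. Leaving `U` would
mean crossing `∂U`, where the extensions agree. -/

theorem UnitSph.norm_coe (x : UnitSph n) : ‖(x : EuclideanSpace ℝ (Fin n))‖ = 1 :=
  norm_eq_of_mem_sphere x

theorem UnitSph.coe_ne_zero (x : UnitSph n) : (x : EuclideanSpace ℝ (Fin n)) ≠ 0 := by
  rw [← norm_ne_zero_iff, x.norm_coe]
  exact one_ne_zero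

theorem roundDist_self (x : UnitSph n) : roundDist x x = 0 :=
  InnerProductGeometry.angle_self x.coe_ne_zero

theorem roundDist_comm (x y : UnitSph n) : roundDist x y = roundDist y x :=
  InnerProductGeometry.angle_comm _ _

theorem roundDist_nonneg (x y : UnitSph n) : 0 ≤ roundDist x y :=
  InnerProductGeometry.angle_nonneg _ _

theorem roundDist_triangle (x y z : UnitSph n) :
    roundDist x z ≤ roundDist x y + roundDist y z :=
  InnerProductGeometry.angle_le_angle_add_angle _ _ _

theorem roundDist_eq_arccos (x y : UnitSph n) : roundDist x y =
    Real.arccos (inner ℝ (x : EuclideanSpace ℝ (Fin n)) (y : EuclideanSpace ℝ (Fin n))) := by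
  rw [roundDist, InnerProductGeometry.angle, x.norm_coe, y.norm_coe, mul_one, div_one]

theorem continuous_roundDist_left (x : UnitSph n) : Continuous (roundDist x) := by
  rw [funext (roundDist_eq_arccos x)]
  exact Real.continuous_arccos.comp (continuous_const.inner continuous_subtype_val)

theorem tendsto_roundDist_nhds (x : UnitSph n) : Tendsto (roundDist x) (𝓝 x) (𝓝 0) := by
  have h := (continuous_roundDist_left x).tendsto x
  rwa [roundDist_self] at h

/-- The round distance as a function of the length of the chord. -/
theorem roundDist_eq_two_mul_arcsin (x y : UnitSph n) :
    roundDist x y =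
      2 * Real.arcsin (‖(y : EuclideanSpace ℝ (Fin n)) - (x : EuclideanSpace ℝ (Fin n))‖ / 2) := by
  have h0 := roundDist_nonneg x y
  have hpi : roundDist x y ≤ Real.pi := InnerProductGeometry.angle_le_pi _ _
  have hs : 0 ≤ Real.sin (roundDist x y / 2) :=
    Real.sin_nonneg_of_nonneg_of_le_pi (by linarith) (by linarith)
  -- Chord length: `‖y - x‖² = 2 - 2 cos θ = 4 sin² (θ / 2)`.
  have hc : ‖(y : EuclideanSpace ℝ (Fin n)) - (x : EuclideanSpace ℝ (Fin n))‖
      = 2 * Real.sin (roundDist x y / 2) := by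
    rw [← sq_eq_sq₀ (norm_nonneg _) (by positivity), norm_sub_sq_real, x.norm_coe, y.norm_coe,
      real_inner_comm, InnerProductGeometry.inner_eq_cos_angle_of_norm_eq_one x.norm_coe y.norm_coe]
    have h2 := Real.cos_two_mul (roundDist x y / 2)
    rw [mul_div_cancel₀ _ (two_ne_zero' ℝ)] at h2
    have h3 := Real.sin_sq_add_cos_sq (roundDist x y / 2)
    change _ - 2 * Real.cos (roundDist x y) + _ = _
    rw [h2]
    linarith
  rw [hc, mul_div_cancel_left₀ _ (two_ne_zero' ℝ), Real.arcsin_sin (by linarith) (by linarith)]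
  ring

/-- Along a differentiable curve on the sphere, the round distance to the base point has the
speed of the curve as its right derivative. -/
theorem hasDerivWithinAt_roundDist {c : ℝ → UnitSph n} {c' : EuclideanSpace ℝ (Fin n)} {x : ℝ}
    (hc : HasDerivWithinAt (fun τ => (c τ : EuclideanSpace ℝ (Fin n))) c' (Ioi x) x) :
    HasDerivWithinAt (fun τ => roundDist (c x) (c τ)) ‖c'‖ (Ioi x) x := by
  have hx : x ∉ Ioi x := self_notMem_Ioi
  have hnorm : HasDerivWithinAt (fun τ => ‖(c τ : EuclideanSpace ℝ (Fin n)) - c x‖) ‖c'‖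
      (Ioi x) x := by
    rw [hasDerivWithinAt_iff_tendsto_slope' hx] at hc ⊢
    refine hc.norm.congr' ?_
    filter_upwards [self_mem_nhdsWithin] with z hz
    have hz' : 0 < z - x := sub_pos.2 hz
    simp [slope_def_module, norm_smul, abs_of_pos hz']
  have harc : HasDerivAt (fun u : ℝ => 2 * Real.arcsin (u / 2)) 1
      ‖(c x : EuclideanSpace ℝ (Fin n)) - c x‖ := by
    have h1 : HasDerivAt Real.arcsin 1 ((0 : ℝ) / 2) := by
      simpa using Real.hasDerivAt_arcsin (x := 0) (by norm_num) (by norm_num)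
    have h2 := ((h1.comp 0 ((hasDerivAt_id (0 : ℝ)).div_const 2)).const_mul 2)
    simpa [Function.comp_def] using h2
  have h := harc.comp_hasDerivWithinAt x hnorm
  simpa [Function.comp_def, roundDist_eq_two_mul_arcsin] using h

end RoundDistance

/-! ### Causal curves and the causal order. -/

section CausalCurves

variable {n : ℕ} {γ : ℝ → EinUniv n} {a b : ℝ}

theorem continuousOn_of_einEmb {s : Set ℝ} (h : ContinuousOn (fun τ => einEmb n (γ τ)) s) :
    ContinuousOn γ s := by
  have h1 : ContinuousOn (fun τ => ((γ τ).1 : EuclideanSpace ℝ (Fin n))) s := h.fst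
  have h2 : ContinuousOn (fun τ => (γ τ).2) s := h.snd
  exact (Topology.IsEmbedding.subtypeVal.continuousOn_iff.2 h1).prodMk h2

/-- Causality bounds spatial speed by the rate of time. The distance to a fixed point need not be
differentiable along the curve, but the triangle inequality bounds its right slopes by those of the
distance to the current point, whose right derivative is the speed; this suffices for a one-sided
mean value inequality. -/
theorem IsFutureCausalArc.roundDist_le (h : IsFutureCausalArc γ a b) {σ τ : ℝ} (hσ : a ≤ σ)
    (hστ : σ ≤ τ) (hτ : τ ≤ b) : roundDist (γ σ).1 (γ τ).1 ≤ (γ τ).2 - (γ σ).2 := by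
  obtain ⟨-, hC, hcaus⟩ := h
  have hcont : ContinuousOn γ (Icc σ b) :=
    (continuousOn_of_einEmb hC.continuousOn).mono (Icc_subset_Icc_left hσ)
  set v := derivWithin (fun τ => einEmb n (γ τ)) (Icc a b) with hv
  have hder : ∀ x ∈ Ico σ b, HasDerivWithinAt (fun τ => einEmb n (γ τ)) (v x) (Ici x) x := by
    intro x hx
    have hx' : x ∈ Ico a b := ⟨hσ.trans hx.1, hx.2⟩
    exact (hC.differentiableOn one_ne_zero x
      ⟨hx'.1, hx'.2.le⟩).hasDerivWithinAt.mono_of_mem_nhdsWithin (Icc_mem_nhdsGE_of_mem hx')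
  have hder1 : ∀ x ∈ Ico σ b,
      HasDerivWithinAt (fun τ => ((γ τ).1 : EuclideanSpace ℝ (Fin n))) (v x).1 (Ici x) x :=
    fun x hx => (hder x hx).hasFDerivWithinAt.fst.hasDerivWithinAt.congr_deriv (by simp)
  have hder2 : ∀ x ∈ Ico σ b, HasDerivWithinAt (fun τ => (γ τ).2) (v x).2 (Ici x) x :=
    fun x hx => (hder x hx).hasFDerivWithinAt.snd.hasDerivWithinAt.congr_deriv (by simp)
  refine image_le_of_liminf_slope_right_le_deriv_boundary
    (f := fun τ => roundDist (γ σ).1 (γ τ).1) (B := fun τ => (γ τ).2 - (γ σ).2)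
    (B' := fun τ => (v τ).2) (a := σ) (b := b) ?_ ?_ ?_ ?_ ?_ ⟨hστ, hτ⟩
  · exact (continuous_roundDist_left (γ σ).1).comp_continuousOn hcont.fst
  · simp [roundDist_self]
  · exact hcont.snd.sub continuousOn_const
  · intro x hx
    exact (hder2 x hx).sub_const _
  · intro x hx r hr
    obtain ⟨-, hform, hpos⟩ := hcaus x ⟨hσ.trans hx.1, hx.2.le⟩
    have hle : ‖(v x).1‖ ≤ (v x).2 := by
      rw [← sq_le_sq₀ (norm_nonneg _) hpos.le]
      exact sub_nonpos.1 hform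
    have hslope := (hasDerivWithinAt_iff_tendsto_slope' self_notMem_Ioi).1
      (hasDerivWithinAt_roundDist ((hder1 x hx).mono Ioi_subset_Ici_self))
    refine Eventually.frequently ?_
    filter_upwards [hslope.eventually_lt_const (hle.trans_lt hr), self_mem_nhdsWithin] with z hz hxz
    refine lt_of_le_of_lt ?_ hz
    have hxz' : 0 < z - x := sub_pos.2 hxz
    have := roundDist_triangle (γ σ).1 (γ x).1 (γ z).1
    simp only [slope_def_field, roundDist_self]
    exact div_le_div_of_nonneg_right (by linarith) hxz'.le

theorem IsFutureCausalCurve.lt (h : IsFutureCausalCurve γ a b) : a < b := by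
  induction h with
  | arc h => exact h.1
  | concat _ _ h₁ h₂ => exact h₁.trans h₂

theorem IsFutureCausalCurve.continuousOn (h : IsFutureCausalCurve γ a b) :
    ContinuousOn γ (Icc a b) := by
  induction h with
  | arc h => exact continuousOn_of_einEmb h.2.1.continuousOn
  | concat h h' h₁ h₂ =>
    rw [← Icc_union_Icc_eq_Icc h.lt.le h'.lt.le]
    exact h₁.union_of_isClosed h₂ isClosed_Icc isClosed_Icc

theorem IsFutureCausalCurve.roundDist_le (h : IsFutureCausalCurve γ a b) {σ τ : ℝ} (hσ : a ≤ σ)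
    (hστ : σ ≤ τ) (hτ : τ ≤ b) : roundDist (γ σ).1 (γ τ).1 ≤ (γ τ).2 - (γ σ).2 := by
  induction h generalizing σ τ with
  | arc h => exact h.roundDist_le hσ hστ hτ
  | @concat a b c h h' h₁ h₂ =>
    rcases le_total τ b with hb | hb
    · exact h₁ hσ hστ hb
    rcases le_total b σ with hb' | hb'
    · exact h₂ hb' hστ hτ
    · have := roundDist_triangle (γ σ).1 (γ b).1 (γ τ).1
      have := h₁ hσ hb' le_rfl
      have := h₂ le_rfl hb hτ
      linarith

theorem IsFutureCausalArc.congr {γ' : ℝ → EinUniv n} (h : IsFutureCausalArc γ a b)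
    (hγ : EqOn γ' γ (Icc a b)) : IsFutureCausalArc γ' a b := by
  have hE : EqOn (fun τ => einEmb n (γ' τ)) (fun τ => einEmb n (γ τ)) (Icc a b) :=
    fun τ hτ => congrArg (einEmb n) (hγ hτ)
  refine ⟨h.1, h.2.1.congr hE, fun τ hτ => ?_⟩
  rw [derivWithin_congr hE (hE hτ)]
  exact h.2.2 τ hτ

/-- Two points of the sphere of a space of dimension at least two lie on a great circle. -/
theorem exists_unit_orthogonal_eq_cos_add_sin (hn : 2 ≤ n) (x y : UnitSph n) :
    ∃ v : EuclideanSpace ℝ (Fin n), ‖v‖ = 1 ∧ inner ℝ (x : EuclideanSpace ℝ (Fin n)) v = 0 ∧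
      (y : EuclideanSpace ℝ (Fin n)) =
        Real.cos (roundDist x y) • (x : EuclideanSpace ℝ (Fin n)) +
          Real.sin (roundDist x y) • v := by
  set X : EuclideanSpace ℝ (Fin n) := x.1
  set Y : EuclideanSpace ℝ (Fin n) := y.1
  have hX : ‖X‖ = 1 := x.norm_coe
  have hY : ‖Y‖ = 1 := y.norm_coe
  have hXY : inner ℝ X Y = Real.cos (roundDist x y) :=
    InnerProductGeometry.inner_eq_cos_angle_of_norm_eq_one hX hY
  set w := Y - Real.cos (roundDist x y) • X with hw
  have hXw : inner ℝ X w = 0 := by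
    rw [hw, inner_sub_right, inner_smul_right, real_inner_self_eq_norm_sq, hX, hXY]
    ring
  have hs : 0 ≤ Real.sin (roundDist x y) := InnerProductGeometry.sin_angle_nonneg _ _
  have hwn : ‖w‖ = Real.sin (roundDist x y) := by
    rw [← sq_eq_sq₀ (norm_nonneg _) hs, hw, norm_sub_sq_real, norm_smul, inner_smul_right,
      real_inner_comm, hXY, hX, hY, Real.sin_sq, Real.norm_eq_abs, mul_one, sq_abs]
    ring
  have hYw : Y = Real.cos (roundDist x y) • X + w := by rw [hw]; abel
  -- If `w = 0` then `y = ± x` and the sine vanishes, so any unit vector orthogonal to `x` serves;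
  -- `2 ≤ n` supplies one.
  by_cases h0 : w = 0
  · have hfin : 0 < Module.finrank ℝ (Submodule.span ℝ {X})ᗮ := by
      have h1 := Submodule.finrank_add_finrank_orthogonal (Submodule.span ℝ {X})
      rw [finrank_span_singleton x.coe_ne_zero, finrank_euclideanSpace_fin] at h1
      omega
    have := Module.finrank_pos_iff.1 hfin
    obtain ⟨v, hv⟩ := exists_norm_eq (Submodule.span ℝ {X})ᗮ zero_le_one
    refine ⟨v, hv, Submodule.mem_orthogonal_singleton_iff_inner_right.1 v.2, ?_⟩
    rw [← hwn, h0, norm_zero, zero_smul, add_zero]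
    rwa [h0, add_zero] at hYw
  · have hne : ‖w‖ ≠ 0 := norm_ne_zero_iff.2 h0
    refine ⟨‖w‖⁻¹ • w, ?_, ?_, ?_⟩
    · rw [norm_smul, norm_inv, norm_norm, inv_mul_cancel₀ hne]
    · rw [inner_smul_right, hXw, mul_zero]
    · rw [← hwn, smul_smul, mul_inv_cancel₀ hne, one_smul]
      exact hYw

/-- Points whose time difference dominates their round distance are joined by a causal arc. -/
theorem exists_isFutureCausalArc (hn : 2 ≤ n) (hab : a < b) (p q : EinUniv n) (hpq : p.2 < q.2)
    (hd : roundDist p.1 q.1 ≤ q.2 - p.2) :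
    ∃ γ : ℝ → EinUniv n, IsFutureCausalArc γ a b ∧ γ a = p ∧ γ b = q := by
  obtain ⟨v, hv, hxv, hy⟩ := exists_unit_orthogonal_eq_cos_add_sin hn p.1 q.1
  set X : EuclideanSpace ℝ (Fin n) := p.1.1 with hXdef
  set θ := roundDist p.1 q.1 with hθ
  have hX : ‖X‖ = 1 := p.1.norm_coe
  have hba : 0 < b - a := sub_pos.2 hab
  have hpyth : ∀ s t : ℝ, ‖s • X + t • v‖ ^ 2 = s ^ 2 + t ^ 2 := by
    intro s t
    rw [norm_add_sq_real, norm_smul, norm_smul, inner_smul_left, inner_smul_right, hxv, hX, hv]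
    simp
  let α : ℝ → ℝ := fun τ => (τ - a) / (b - a)
  have hα : ∀ τ, HasDerivAt α (1 / (b - a)) τ := fun τ =>
    ((hasDerivAt_id τ).sub_const a).div_const (b - a)
  -- A great circle run at constant speed `θ / (b - a)`, while time advances at rate `(q.2 - p.2) /
  -- (b - a)`.
  let c : ℝ → EuclideanSpace ℝ (Fin n) := fun τ =>
    Real.cos (θ * α τ) • X + Real.sin (θ * α τ) • v
  have hc : ∀ τ, c τ ∈ Metric.sphere (0 : EuclideanSpace ℝ (Fin n)) 1 := by
    intro τ
    rw [mem_sphere_zero_iff_norm, ← sq_eq_sq₀ (norm_nonneg _) zero_le_one, hpyth,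
      Real.cos_sq_add_sin_sq, one_pow]
  let γ : ℝ → EinUniv n := fun τ => (⟨c τ, hc τ⟩, p.2 + (q.2 - p.2) * α τ)
  have hαa : α a = 0 := by simp [α]
  have hαb : α b = 1 := div_self hba.ne'
  have hder : ∀ τ, HasDerivAt (fun τ => einEmb n (γ τ))
      ((-Real.sin (θ * α τ) * (θ * (1 / (b - a)))) • X +
        (Real.cos (θ * α τ) * (θ * (1 / (b - a)))) • v, (q.2 - p.2) * (1 / (b - a))) τ := by
    intro τ
    have h1 := (hα τ).const_mul θ
    exact ((h1.cos.smul_const X).add (h1.sin.smul_const v)).prodMk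
      (((hα τ).const_mul (q.2 - p.2)).const_add p.2)
  refine ⟨γ, ⟨hab, ContDiff.contDiffOn ?_, ?_⟩, ?_, ?_⟩
  · change ContDiff ℝ 1 fun τ => (Real.cos (θ * ((τ - a) / (b - a))) • X +
      Real.sin (θ * ((τ - a) / (b - a))) • v, p.2 + (q.2 - p.2) * ((τ - a) / (b - a)))
    fun_prop
  · intro τ hτ
    rw [(hder τ).hasDerivWithinAt.derivWithin (uniqueDiffOn_Icc hab τ hτ)]
    have hpos : 0 < (q.2 - p.2) * (1 / (b - a)) :=
      mul_pos (sub_pos.2 hpq) (one_div_pos.2 hba)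
    refine ⟨fun h => hpos.ne' (congrArg Prod.snd h), ?_, hpos⟩
    rw [lorentzForm, sub_nonpos, hpyth]
    have h1 : (θ * (1 / (b - a))) ^ 2 ≤ ((q.2 - p.2) * (1 / (b - a))) ^ 2 := by
      have := roundDist_nonneg p.1 q.1
      gcongr
    refine le_trans (le_of_eq ?_) h1
    linear_combination (θ * (1 / (b - a))) ^ 2 * Real.sin_sq_add_cos_sq (θ * α τ)
  · refine Prod.ext (Subtype.ext ?_) ?_
    · simp [γ, c, hαa, X]
    · simp [γ, hαa]
  · refine Prod.ext (Subtype.ext ?_) ?_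
    · simp [γ, c, hαb, hy]
    · simp [γ, hαb]

/-- A causally convex set contains every point lying between two of its points. -/
theorem CausallyConvex.mem_of_between (hn : 2 ≤ n) {Ω : Set (EinUniv n)} (hΩ : CausallyConvex Ω)
    {p m q : EinUniv n} (hp : p ∈ Ω) (hq : q ∈ Ω) (hpm : p.2 < m.2) (hmq : m.2 < q.2)
    (hdpm : roundDist p.1 m.1 ≤ m.2 - p.2) (hdmq : roundDist m.1 q.1 ≤ q.2 - m.2) : m ∈ Ω := by
  obtain ⟨γ₁, h₁, h₁p, h₁m⟩ :=
    exists_isFutureCausalArc hn (zero_lt_one (α := ℝ)) p m hpm hdpm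
  obtain ⟨γ₂, h₂, h₂m, h₂q⟩ := exists_isFutureCausalArc hn (one_lt_two (α := ℝ)) m q hmq hdmq
  let γ : ℝ → EinUniv n := fun τ => if τ ≤ 1 then γ₁ τ else γ₂ τ
  have e₁ : EqOn γ γ₁ (Icc 0 1) := fun τ hτ => if_pos hτ.2
  have e₂ : EqOn γ γ₂ (Icc 1 2) := by
    intro τ hτ
    rcases hτ.1.eq_or_lt with rfl | hlt
    · exact (if_pos le_rfl).trans (h₁m.trans h₂m.symm)
    · exact if_neg hlt.not_ge
  have hγ : IsFutureCausalCurve γ 0 2 := .concat (.arc (h₁.congr e₁)) (.arc (h₂.congr e₂))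
  have h := hΩ p hp q hq γ 0 2 hγ ((e₁ (by simp)).trans h₁p) ((e₂ (by simp)).trans h₂q) 1
    ⟨zero_le_one, one_le_two⟩
  rwa [e₁ (by simp), h₁m] at h

end CausalCurves

/-! ### Extended-real Lipschitz functions and their extension. -/

section LipschitzExtension

variable {n : ℕ} {f : UnitSph n → EReal} {U : Set (UnitSph n)}

/-- Round distances are finite, so one infinite value forces a constant function; otherwise the
function is real-valued and squeezed between `f x ± d(x, ·)`. -/
theorem IsOneLipschitzOn.continuous (hf : IsOneLipschitzOn f univ) : Continuous f := by
  rcases isEmpty_or_nonempty (UnitSph n) with hE | ⟨⟨x₀⟩⟩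
  · exact continuous_of_const fun x => hE.elim x
  have hconst : ∀ x y, f x = ⊥ → f y = ⊥ := by
    intro x y hx
    have := hf y (mem_univ _) x (mem_univ _)
    rwa [hx, EReal.bot_add, le_bot_iff] at this
  have hconst' : ∀ x y, f x = ⊤ → f y = ⊤ := by
    intro x y hx
    have := hf x (mem_univ _) y (mem_univ _)
    rw [hx, top_le_iff] at this
    by_contra hy
    exact (EReal.add_lt_top hy (EReal.coe_ne_top _)).ne this
  by_cases hbot : f x₀ = ⊥
  · exact continuous_of_const fun x y => (hconst x₀ x hbot).trans (hconst x₀ y hbot).symm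
  by_cases htop : f x₀ = ⊤
  · exact continuous_of_const fun x y => (hconst' x₀ x htop).trans (hconst' x₀ y htop).symm
  have hreal : ∀ x, ((f x).toReal : EReal) = f x := fun x =>
    EReal.coe_toReal (fun h => htop (hconst' x x₀ h)) (fun h => hbot (hconst x x₀ h))
  have hle : ∀ x y, (f x).toReal ≤ (f y).toReal + roundDist x y := by
    intro x y
    have := hf x (mem_univ _) y (mem_univ _)
    rw [← hreal x, ← hreal y] at this
    exact_mod_cast this
  rw [← funext hreal]
  refine continuous_coe_real_ereal.comp (continuous_iff_continuousAt.2 fun x => ?_)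
  have hd := tendsto_roundDist_nhds x
  refine tendsto_of_tendsto_of_tendsto_of_le_of_le
    (g := fun y => (f x).toReal - roundDist x y) (h := fun y => (f x).toReal + roundDist x y)
    ?_ ?_ (fun y => ?_) (fun y => ?_)
  · simpa using tendsto_const_nhds.sub hd
  · simpa using tendsto_const_nhds.add hd
  · exact sub_le_iff_le_add.2 (hle x y)
  · simpa only [roundDist_comm x y] using hle y x

/-- The McShane extension: a `1`-Lipschitz function on a subset of the sphere extends to the whole
sphere. -/
theorem IsOneLipschitzOn.exists_extension (hf : IsOneLipschitzOn f U) :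
    ∃ F : UnitSph n → EReal, IsOneLipschitzOn F univ ∧ EqOn f F U := by
  -- For empty `U` the infimum is `⊤`, and the constant `⊤` is also `1`-Lipschitz.
  refine ⟨fun x => ⨅ y ∈ U, f y + ((roundDist x y : ℝ) : EReal), fun x _ y _ => ?_, fun x hx => ?_⟩
  · refine EReal.sub_le_iff_le_add (.inl (EReal.coe_ne_bot _)) (.inl (EReal.coe_ne_top _)) |>.1 ?_
    refine le_iInf₂ fun z hz => ?_
    refine EReal.sub_le_of_le_add ((iInf₂_le z hz).trans ?_)
    rw [add_assoc, ← EReal.coe_add]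
    gcongr
    linarith [roundDist_triangle x y z]
  · refine le_antisymm (le_iInf₂ fun z hz => hf x hx z hz) ((iInf₂_le x hx).trans ?_)
    simp [roundDist_self]

end LipschitzExtension

/-! ### Regions between graphs and causal convexity. -/

section Characterization

variable {n : ℕ} {Ω : Set (EinUniv n)}

/-- The region of `S^{n-1} × ℝ` lying over `U`, above the graph of `f` and below that of `g`. -/
def regionBetweenGraphs (U : Set (UnitSph n)) (f g : UnitSph n → EReal) : Set (EinUniv n) :=
  {p | p.1 ∈ U ∧ f p.1 < (p.2 : EReal) ∧ (p.2 : EReal) < g p.1}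

theorem isOpen_regionBetweenGraphs {U : Set (UnitSph n)} {f g : UnitSph n → EReal}
    (hU : IsOpen U) (hf : Continuous f) (hg : Continuous g) :
    IsOpen (regionBetweenGraphs U f g) := by
  have ht : Continuous fun p : EinUniv n => (p.2 : EReal) :=
    continuous_coe_real_ereal.comp continuous_snd
  exact (hU.preimage continuous_fst).inter ((isOpen_lt (hf.comp continuous_fst) ht).inter
    (isOpen_lt ht (hg.comp continuous_fst)))

/-- Otherwise the interior and the exterior of `u` would separate `s`. -/
theorem IsPreconnected.inter_frontier_nonempty {X : Type*} [TopologicalSpace X] {s u : Set X}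
    (hs : IsPreconnected s) (hsu : (s ∩ u).Nonempty) (hsu' : ¬ s ⊆ u) :
    (s ∩ frontier u).Nonempty := by
  by_contra hemp
  obtain ⟨x, hxs, hxu⟩ := not_subset.1 hsu'
  obtain ⟨y, hys, hyu⟩ := hsu
  have hmem : ∀ z ∈ s, z ∈ interior u ∨ z ∈ (closure u)ᶜ := by
    intro z hz
    by_contra! h
    exact hemp ⟨z, hz, notMem_compl_iff.1 h.2, h.1⟩
  obtain ⟨z, -, hz, hz'⟩ := hs (interior u) (closure u)ᶜ isOpen_interior
    isClosed_closure.isOpen_compl hmem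
    ⟨y, hys, (hmem y hys).resolve_right fun h => h (subset_closure hyu)⟩
    ⟨x, hxs, (hmem x hxs).resolve_left fun h => hxu (interior_subset h)⟩
  exact hz' (subset_closure (interior_subset hz))

/-- Being above the graph propagates to the causal future; dually, being below it propagates to the
past. -/
theorem IsOneLipschitzOn.lt_of_roundDist_le {f : UnitSph n → EReal} (hf : IsOneLipschitzOn f univ)
    {x y : UnitSph n} {s t : ℝ} (hx : f x < s) (h : roundDist x y ≤ t - s) : f y < t := by
  have h1 : f x + ((roundDist y x : ℝ) : EReal) < s + ((roundDist y x : ℝ) : EReal) :=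
    EReal.add_lt_add_right_coe hx _
  refine (hf y (mem_univ _) x (mem_univ _)).trans_lt (h1.trans_le ?_)
  rw [roundDist_comm] at h
  exact_mod_cast (by linarith : s + roundDist y x ≤ t)

theorem IsOneLipschitzOn.gt_of_roundDist_le {f : UnitSph n → EReal} (hf : IsOneLipschitzOn f univ)
    {x y : UnitSph n} {s t : ℝ} (hy : (t : EReal) < f y) (h : roundDist x y ≤ t - s) :
    (s : EReal) < f x := by
  by_contra! hx
  refine hy.not_ge ((hf y (mem_univ _) x (mem_univ _)).trans ((add_le_add_left hx _).trans ?_))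
  rw [roundDist_comm] at h
  exact_mod_cast (by linarith : s + roundDist y x ≤ t)

theorem causallyConvex_regionBetweenGraphs {U : Set (UnitSph n)} {f g : UnitSph n → EReal}
    (hf : IsOneLipschitzOn f univ) (hg : IsOneLipschitzOn g univ)
    (hfg : EqOn f g (frontier U)) : CausallyConvex (regionBetweenGraphs U f g) := by
  rintro p ⟨hpU, hpf, -⟩ q ⟨-, -, hqg⟩ γ a b hγ rfl rfl
  have hlow : ∀ τ ∈ Icc a b, f (γ τ).1 < (γ τ).2 := fun τ hτ =>
    hf.lt_of_roundDist_le hpf (hγ.roundDist_le le_rfl hτ.1 hτ.2)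
  have hupp : ∀ τ ∈ Icc a b, ((γ τ).2 : EReal) < g (γ τ).1 := fun τ hτ =>
    hg.gt_of_roundDist_le hqg (hγ.roundDist_le hτ.1 hτ.2 le_rfl)
  have hsub : (fun τ => (γ τ).1) '' Icc a b ⊆ U := by
    by_contra hnot
    obtain ⟨-, ⟨τ, hτ, rfl⟩, hfr⟩ :=
      (isPreconnected_Icc.image _ hγ.continuousOn.fst).inter_frontier_nonempty
        ⟨_, ⟨a, left_mem_Icc.2 hγ.lt.le, rfl⟩, hpU⟩ hnot
    -- At a frontier point `f < t < g` contradicts `f = g`.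
    exact ((hlow τ hτ).trans (hupp τ hτ)).ne (hfg hfr)
  exact fun τ hτ => ⟨hsub ⟨τ, hτ, rfl⟩, hlow τ hτ, hupp τ hτ⟩

/-- The infimum of the times at which the vertical line over `x` meets `Ω`. -/
noncomputable def lowerBoundary (Ω : Set (EinUniv n)) (x : UnitSph n) : EReal :=
  ⨅ (t : ℝ) (_ : (x, t) ∈ Ω), (t : EReal)

/-- The supremum of the times at which the vertical line over `x` meets `Ω`. -/
noncomputable def upperBoundary (Ω : Set (EinUniv n)) (x : UnitSph n) : EReal :=
  ⨆ (t : ℝ) (_ : (x, t) ∈ Ω), (t : EReal)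

theorem lowerBoundary_le {x : UnitSph n} {t : ℝ} (h : (x, t) ∈ Ω) : lowerBoundary Ω x ≤ t :=
  iInf₂_le t h

theorem le_upperBoundary {x : UnitSph n} {t : ℝ} (h : (x, t) ∈ Ω) : t ≤ upperBoundary Ω x :=
  le_iSup₂ (f := fun (t : ℝ) (_ : (x, t) ∈ Ω) => (t : EReal)) t h

theorem exists_lt_of_lowerBoundary_lt {x : UnitSph n} {r : EReal} (h : lowerBoundary Ω x < r) :
    ∃ t : ℝ, (x, t) ∈ Ω ∧ t < r := by
  simpa only [lowerBoundary, iInf_lt_iff, exists_prop] using h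

theorem exists_gt_of_lt_upperBoundary {x : UnitSph n} {r : EReal} (h : r < upperBoundary Ω x) :
    ∃ t : ℝ, (x, t) ∈ Ω ∧ r < t := by
  simpa only [upperBoundary, lt_iSup_iff, exists_prop] using h

theorem IsOpen.lowerBoundary_lt_and_lt_upperBoundary (hΩ : IsOpen Ω) {x : UnitSph n} {t : ℝ}
    (h : (x, t) ∈ Ω) : lowerBoundary Ω x < t ∧ t < upperBoundary Ω x := by
  have hopen : IsOpen {s : ℝ | (x, s) ∈ Ω} := hΩ.preimage (by fun_prop)
  obtain ⟨ε, hε, hball⟩ := Metric.isOpen_iff.1 hopen t h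
  have hl : t - ε / 2 ∈ Metric.ball t ε := by
    rw [Metric.mem_ball, Real.dist_eq, abs_lt]; constructor <;> linarith
  have hr : t + ε / 2 ∈ Metric.ball t ε := by
    rw [Metric.mem_ball, Real.dist_eq, abs_lt]; constructor <;> linarith
  exact ⟨(lowerBoundary_le (hball hl)).trans_lt (by exact_mod_cast (by linarith)),
    lt_of_lt_of_le (by exact_mod_cast (by linarith)) (le_upperBoundary (hball hr))⟩

/-- If `(y, s) ∈ Ω` and `s + d(x, y) < r < lowerBoundary Ω x`, then `(x, r)` lies between `(y, s)`
and a point of `Ω` over `x`, hence in `Ω`, which is absurd. The upper boundary is the time-reversed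
case. -/
theorem CausallyConvex.isOneLipschitzOn_lowerBoundary (hn : 2 ≤ n) (hΩ : CausallyConvex Ω) :
    IsOneLipschitzOn (lowerBoundary Ω) (Prod.fst '' Ω) := by
  rintro x ⟨⟨x, t⟩, hxt, rfl⟩ y -
  refine EReal.sub_le_iff_le_add (.inl (EReal.coe_ne_bot _)) (.inl (EReal.coe_ne_top _)) |>.1 ?_
  refine le_iInf₂ fun s hs => EReal.sub_le_of_le_add ?_
  by_contra! hlt
  obtain ⟨r, hr, hr'⟩ := EReal.lt_iff_exists_real_btwn.1 hlt
  have hsr : s + roundDist x y < r := by exact_mod_cast hr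
  have hrt : r < t := by exact_mod_cast hr'.trans_le (lowerBoundary_le hxt)
  have := roundDist_nonneg x y
  refine hr'.not_ge (lowerBoundary_le
    (hΩ.mem_of_between (m := (x, r)) hn hs hxt ?_ hrt ?_ ?_))
  · change s < r
    linarith
  · change roundDist y x ≤ r - s
    rw [roundDist_comm]
    linarith
  · change roundDist x x ≤ t - r
    rw [roundDist_self]
    linarith

theorem CausallyConvex.isOneLipschitzOn_upperBoundary (hn : 2 ≤ n) (hΩ : CausallyConvex Ω) :
    IsOneLipschitzOn (upperBoundary Ω) (Prod.fst '' Ω) := by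
  rintro x - y ⟨⟨y, t⟩, hyt, rfl⟩
  refine iSup₂_le fun s hs => EReal.sub_le_iff_le_add (.inl (EReal.coe_ne_bot _))
    (.inl (EReal.coe_ne_top _)) |>.1 ?_
  by_contra! hlt
  obtain ⟨r, hr, hr'⟩ := EReal.lt_iff_exists_real_btwn.1 hlt
  have hrs : r < s - roundDist x y := by exact_mod_cast hr'
  have htr : t < r := by exact_mod_cast (le_upperBoundary hyt).trans_lt hr
  have := roundDist_nonneg x y
  refine hr.not_ge (le_upperBoundary
    (hΩ.mem_of_between (m := (y, r)) hn hyt hs htr ?_ ?_ ?_))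
  · change r < s
    linarith
  · change roundDist y y ≤ r - t
    rw [roundDist_self]
    linarith
  · change roundDist y x ≤ s - r
    rw [roundDist_comm]
    linarith

theorem CausallyConvex.eq_regionBetweenGraphs (hn : 2 ≤ n) (hopen : IsOpen Ω)
    (hΩ : CausallyConvex Ω) :
    Ω = regionBetweenGraphs (Prod.fst '' Ω) (lowerBoundary Ω) (upperBoundary Ω) := by
  ext ⟨x, r⟩
  refine ⟨fun h => ⟨⟨_, h, rfl⟩, hopen.lowerBoundary_lt_and_lt_upperBoundary h⟩, ?_⟩
  rintro ⟨-, hl, hu⟩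
  obtain ⟨s, hs, hsr⟩ := exists_lt_of_lowerBoundary_lt hl
  obtain ⟨t, ht, hrt⟩ := exists_gt_of_lt_upperBoundary hu
  have hsr' : s < r := by exact_mod_cast hsr
  have hrt' : r < t := by exact_mod_cast hrt
  refine hΩ.mem_of_between hn hs ht hsr' hrt' ?_ ?_
  · change roundDist x x ≤ r - s
    rw [roundDist_self]
    linarith
  · change roundDist x x ≤ t - r
    rw [roundDist_self]
    linarith

theorem CausallyConvex.boundaryExtensionsCoincide {U : Set (UnitSph n)} {f g : UnitSph n → EReal}
    (hn : 2 ≤ n) (hU : IsOpen U) (hf : IsOneLipschitzOn f U) (hg : IsOneLipschitzOn g U)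
    (hfg : ∀ x ∈ U, f x < g x) (hΩ : CausallyConvex (regionBetweenGraphs U f g)) :
    BoundaryExtensionsCoincide f g U := by
  intro x hx
  obtain ⟨F, hF, hfF⟩ := hf.exists_extension
  obtain ⟨G, hG, hgG⟩ := hg.exists_extension
  have hfx : Tendsto f (𝓝[U] x) (𝓝 (F x)) :=
    ((hF.continuous.tendsto x).mono_left nhdsWithin_le_nhds).congr'
      (eventually_nhdsWithin_of_forall fun y hy => (hfF hy).symm)
  have hgx : Tendsto g (𝓝[U] x) (𝓝 (G x)) :=
    ((hG.continuous.tendsto x).mono_left nhdsWithin_le_nhds).congr'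
      (eventually_nhdsWithin_of_forall fun y hy => (hgG hy).symm)
  have hne : (𝓝[U] x).NeBot := mem_closure_iff_nhdsWithin_neBot.1 hx.1
  have hle : F x ≤ G x := le_of_tendsto_of_tendsto hfx hgx
    (eventually_nhdsWithin_of_forall fun y hy => (hfg y hy).le)
  refine ⟨F x, hfx, ?_⟩
  suffices h : F x = G x by rwa [h]
  by_contra hFG
  obtain ⟨r, hFr, hrG⟩ := EReal.lt_iff_exists_real_btwn.1 (hle.lt_of_ne hFG)
  -- Choose `F x < s < r < t < G x`. For `y ∈ U` close to `x`, both `(y, s)` and `(y, t)` are in the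
  -- region and `(x, r)` lies causally between them, although the open set `U` omits its frontier
  -- point `x`.
  obtain ⟨s, hFs, hsr⟩ := EReal.lt_iff_exists_real_btwn.1 hFr
  obtain ⟨t, hrt, htG⟩ := EReal.lt_iff_exists_real_btwn.1 hrG
  have hsr' : s < r := by exact_mod_cast hsr
  have hrt' : r < t := by exact_mod_cast hrt
  have hd : Tendsto (roundDist x) (𝓝[U] x) (𝓝 0) :=
    (tendsto_roundDist_nhds x).mono_left nhdsWithin_le_nhds
  obtain ⟨y, hyU, hys, hyt, hdr, hdt⟩ := (eventually_mem_nhdsWithin.and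
    ((hfx.eventually_lt_const hFs).and ((hgx.eventually_const_lt htG).and
      ((hd.eventually_lt_const (sub_pos.2 hsr')).and
        (hd.eventually_lt_const (sub_pos.2 hrt')))))).exists
  have hst : (s : EReal) < t := by exact_mod_cast hsr'.trans hrt'
  have hmem : (x, r) ∈ regionBetweenGraphs U f g :=
    hΩ.mem_of_between hn (p := (y, s)) (q := (y, t)) ⟨hyU, hys, hst.trans hyt⟩
      ⟨hyU, hys.trans hst, hyt⟩ hsr' hrt' ((roundDist_comm y x).trans_le hdr.le) hdt.le
  rw [hU.frontier_eq] at hx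
  exact hx.2 hmem.1

end Characterization

theorem mainTheorem10 (n : ℕ) (hn : 3 ≤ n) (Ω : Set (EinUniv n)) :
    (IsOpen Ω ∧ CausallyConvex Ω) ↔
      ∃ (U : Set (UnitSph n)) (fminus fplus : UnitSph n → EReal),
        IsOpen U ∧
        IsOneLipschitzOn fminus U ∧
        IsOneLipschitzOn fplus U ∧
        (∀ x ∈ U, fminus x < fplus x) ∧
        BoundaryExtensionsCoincide fminus fplus U ∧
        Ω = {p : EinUniv n | p.1 ∈ U ∧ fminus p.1 < (p.2 : EReal) ∧ (p.2 : EReal) < fplus p.1} := by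
  have hn2 : 2 ≤ n := by omega
  constructor
  · rintro ⟨hopen, hΩ⟩
    have hU : IsOpen (Prod.fst '' Ω) := isOpenMap_fst _ hopen
    have hlow := hΩ.isOneLipschitzOn_lowerBoundary hn2
    have hupp := hΩ.isOneLipschitzOn_upperBoundary hn2
    have hlt : ∀ x ∈ Prod.fst '' Ω, lowerBoundary Ω x < upperBoundary Ω x := by
      rintro - ⟨⟨x, t⟩, h, rfl⟩
      exact (hopen.lowerBoundary_lt_and_lt_upperBoundary h).1.trans
        (hopen.lowerBoundary_lt_and_lt_upperBoundary h).2
    have heq := hΩ.eq_regionBetweenGraphs hn2 hopen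
    exact ⟨_, _, _, hU, hlow, hupp, hlt,
      CausallyConvex.boundaryExtensionsCoincide hn2 hU hlow hupp hlt (heq ▸ hΩ), heq⟩
  · rintro ⟨U, f, g, hU, hf, hg, -, hbd, rfl⟩
    obtain ⟨F, hF, hfF⟩ := hf.exists_extension
    obtain ⟨G, hG, hgG⟩ := hg.exists_extension
    have hFG : EqOn F G (frontier U) := by
      intro x hx
      -- By continuity both extensions take the common boundary limit `l` at `x`.
      obtain ⟨l, hfl, hgl⟩ := hbd x hx
      have hne : (𝓝[U] x).NeBot := mem_closure_iff_nhdsWithin_neBot.1 hx.1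
      have hFl : Tendsto F (𝓝[U] x) (𝓝 l) := hfl.congr' (eventually_nhdsWithin_of_forall hfF)
      have hGl : Tendsto G (𝓝[U] x) (𝓝 l) := hgl.congr' (eventually_nhdsWithin_of_forall hgG)
      rw [tendsto_nhds_unique ((hF.continuous.tendsto x).mono_left nhdsWithin_le_nhds) hFl,
        tendsto_nhds_unique ((hG.continuous.tendsto x).mono_left nhdsWithin_le_nhds) hGl]
    have heq : {p : EinUniv n | p.1 ∈ U ∧ f p.1 < (p.2 : EReal) ∧ (p.2 : EReal) < g p.1} =
        regionBetweenGraphs U F G := by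
      ext p
      refine and_congr_right fun hp => ?_
      rw [hfF hp, hgG hp]
    rw [heq]
    exact ⟨isOpen_regionBetweenGraphs hU hF.continuous hG.continuous,
      causallyConvex_regionBetweenGraphs hF hG hFG⟩
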